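/- \textbf{Model.} There are $n\ge 3$ candidates; candidate $i\in[n]$ has utility $\rho_i\ge 0$ for a receiver and $\xi_i\ge 0$ for a sender, where the $\rho_i$ are pairwise distinct and the $\xi_i$ are pairwise distinct. Let $c_R=\arg\max_i\rho_i$, $c_S=\arg\max_i\xi_i$, $\xi_{\max}=\max_i\xi_i$. The candidates arrive one per round, in rounds $1,\dots,n$, in uniformly random order. The receiver knows the set of pairs $(\rho_i,\xi_i)$ and the distribution of the arrival order. The sender knows $n$ but not the pairs; in round $t$ she observes the pair of the arriving candidate and sends a signal $\sigma_t\in\{\mathrm{HIRE},\mathrm{NOT}\}$, which may depend on the pairs of the candidates that arrived in rounds $1,\dots,t$ and on internal randomness drawn at the start. Besides her a-priori information and the mechanism, to which the sender is committed, the receiver observes only the signals (no disclosure). After $\sigma_t$ she either irrevocably hires the current candidate, which ends the process, or rejects it for good. The receiver wants to maximize the probability of hiring $c_R$. The mechanism is \emph{persuasive} if, for all values as above, every round $t$ and every sequence of signals $(\mathrm{NOT},\dots,\mathrm{NOT},\sigma_t)$ of positive probability for rounds $1,\dots,t$, the following holds. Among all strategies of a receiver who has not hired before round $t$ (deciding in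 each round $r\ge t$ as a function of $\sigma_1,\dots,\sigma_r$), the obedient one, which hires exactly upon $\mathrm{HIRE}$, maximizes the probability of hiring $c_R$ conditional on the signals of rounds $1,\dots,t$. \textbf{Simple Secretary mechanism.} Let $s=\lfloor n/e\rfloor$. Once, at the start, set $v=\rho$ with probability $e/n$ and $v=\xi$ with probability $1-e/n$, independently of the arrival order. Signal $\mathrm{NOT}$ in rounds $1,\dots,s$, then signal $\mathrm{HIRE}$ on the first candidate in a round $t>s$ whose $v$-value exceeds those of all earlier candidates; if no $\mathrm{HIRE}$ was sent in rounds $1,\dots,n-1$, signal $\mathrm{HIRE}$ in round $n$. After a $\mathrm{HIRE}$ signal, all later signals are $\mathrm{NOT}$. \textbf{Theorem.} For every $n\ge 3$ the Simple Secretary mechanism is persuasive. Moreover, there is a sequence $(\varepsilon_n)$ with $\varepsilon_n\to 0$ such that, for all $n\ge 3$ and all values as above, if the receiver is obedient, then the probability that $c_S$ is hired differs from $1/e$ by at most $\varepsilon_n$, and the expected sender utility of the hired candidate is at least $(1/e-\varepsilon_n)\,\xi_{\max}$. -/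

import Mathlib

open Filter Topology

noncomputable section

namespace OnlinePersuasion

/-- The two direct signals. -/
inductive Signal
  | HIRE
  | NOT

/-- An instance with `n` candidates: candidate `i` has utility `ρ i` for the receiver and `ξ i`
for the sender.  All utilities are non-negative, and neither player has ties. -/
structure Instance (n : ℕ) where
  ρ : Fin n → ℝ
  ξ : Fin n → ℝ
  ρ_nonneg : ∀ i, 0 ≤ ρ i
  ξ_nonneg : ∀ i, 0 ≤ ξ i
  ρ_injective : Function.Injective ρ
  ξ_injective : Function.Injective ξ

namespace Instance

variable {n : ℕ}

/-- The valuation pair `(ρ, ξ)` of a candidate. -/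
def pair (I : Instance n) (i : Fin n) : ℝ × ℝ := (I.ρ i, I.ξ i)

/-- The largest sender utility. -/
def ξMax (I : Instance n) : ℝ := ⨆ i, I.ξ i

/-- Candidate `c` is the receiver-optimal candidate. -/
def IsReceiverBest (I : Instance n) (c : Fin n) : Prop := ∀ i, I.ρ i ≤ I.ρ c

/-- Candidate `c` is the sender-optimal candidate. -/
def IsSenderBest (I : Instance n) (c : Fin n) : Prop := ∀ i, I.ξ i ≤ I.ξ c

end Instance

/-- A (randomized) direct mechanism for `n` candidates in the secretary scenario without
disclosure.  The sender draws a seed `ω` with probability `law ω`; the signal in round `t`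
depends only on the seed and on the valuation pairs of the candidates that arrived in the rounds
`0, …, t`.  (Rounds are numbered from `0` to `n - 1`.) -/
structure Mechanism (n : ℕ) where
  Seed : Type
  [seedFintype : Fintype Seed]
  law : Seed → ℝ
  law_nonneg : ∀ ω, 0 ≤ law ω
  law_sum : ∑ ω, law ω = 1
  signal : Seed → (t : Fin n) → (Set.Iic t → ℝ × ℝ) → Signal

attribute [instance] Mechanism.seedFintype

/-- A receiver strategy without disclosure: in each round `t`, whether she hires the current
candidate, as a function of the signals of the rounds `0, …, t`. -/
def Strategy (n : ℕ) : Type := (t : Fin n) → (Set.Iic t → Signal) → Prop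

/-- The obedient strategy: hire exactly upon the signal `HIRE`. -/
def obedient (n : ℕ) : Strategy n := fun t h => h ⟨t, Set.mem_Iic.2 le_rfl⟩ = Signal.HIRE

/-- A receiver who has not hired before round `t`, follows `d` from round `t` on and faces the
signals `σ`, hires in round `r`: it is the first round from `t` on in which `d` says to hire. -/
def HiresAt {n : ℕ} (d : Strategy n) (σ : Fin n → Signal) (t : ℕ) (r : Fin n) : Prop :=
  t ≤ r.val ∧ d r (fun i => σ i) ∧
    ∀ q : Fin n, t ≤ q.val → q < r → ¬ d q (fun i => σ i)

namespace Mechanism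

variable {n : ℕ} (M : Mechanism n) (I : Instance n)

/-- The elementary outcomes: an arrival order (`π t` arrives in round `t`) and a seed. -/
abbrev Outcome : Type := Equiv.Perm (Fin n) × M.Seed

/-- The arrival order is uniform and independent of the seed. -/
def weight (o : M.Outcome) : ℝ := (1 / (n.factorial : ℝ)) * M.law o.2

/-- Expectation over arrival order and internal randomness. -/
def expect (f : M.Outcome → ℝ) : ℝ := ∑ o, M.weight o * f o

open Classical in
/-- Probability of an event. -/
def prob (E : M.Outcome → Prop) : ℝ := M.expect fun o => if E o then 1 else 0

/-- Conditional probability of `E` given `H` (used only if `H` has positive probability). -/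
def condProb (E H : M.Outcome → Prop) : ℝ := M.prob (fun o => E o ∧ H o) / M.prob H

/-- The signals sent in all rounds. -/
def signals (o : M.Outcome) (t : Fin n) : Signal :=
  M.signal o.2 t fun i => I.pair (o.1 i)

/-- The receiver, not having hired before round `t` and following `d` from round `t` on, hires
her best candidate. -/
def ReceiverSuccess (d : Strategy n) (t : ℕ) (o : M.Outcome) : Prop :=
  ∃ r, HiresAt d (M.signals I o) t r ∧ I.IsReceiverBest (o.1 r)

/-- The signals of the rounds `0, …, t` are `h`. -/
def HistoryIs (t : Fin n) (h : Set.Iic t → Signal) (o : M.Outcome) : Prop :=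
  ∀ i : Set.Iic t, M.signals I o i = h i

/-- Persuasiveness for ordinal receiver utility without disclosure.  On every instance, in every
round `t` that an obedient receiver can reach without having hired (all earlier signals are
`NOT`), and for every signal she may receive in round `t`, obedience from round `t` on maximizes
her success probability, conditional on the signals she has received, among all strategies. -/
def Persuasive : Prop :=
  ∀ I : Instance n, ∀ (t : Fin n) (h : Set.Iic t → Signal),
    (∀ i : Set.Iic t, (i : Fin n) < t → h i = Signal.NOT) →
    0 < M.prob (M.HistoryIs I t h) →
    ∀ d : Strategy n,
      M.condProb (M.ReceiverSuccess I d t) (M.HistoryIs I t h) ≤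
        M.condProb (M.ReceiverSuccess I (obedient n) t) (M.HistoryIs I t h)

/-- The sender's success probability when the receiver is obedient. -/
def senderSuccess : ℝ :=
  M.prob fun o => ∃ r, HiresAt (obedient n) (M.signals I o) 0 r ∧ I.IsSenderBest (o.1 r)

open Classical in
/-- The sender's expected utility when the receiver is obedient (at most one round `r`
contributes: the one in which the receiver hires). -/
def senderUtility : ℝ :=
  M.expect fun o =>
    ∑ r, if HiresAt (obedient n) (M.signals I o) 0 r then I.ξ (o.1 r) else 0

end Mechanism

/-- The classic algorithm with sample size `s`, before accounting for earlier `HIRE` signals: the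
candidate of round `t` qualifies if `t` is not among the first `s` rounds and the candidate has
the best value so far, or if `t` is the last round. -/
def Qualifies (n s : ℕ) (t : Fin n) (v : Set.Iic t → ℝ) : Prop :=
  (s ≤ t.val ∧ ∀ i : Set.Iic t, (i : Fin n) < t → v i < v ⟨t, Set.mem_Iic.2 le_rfl⟩) ∨ t.val + 1 = n

open Classical in
/-- The classic algorithm signals `HIRE` in the first round whose candidate qualifies, and `NOT`
in all other rounds. -/
def classicSignal (n s : ℕ) (t : Fin n) (v : Set.Iic t → ℝ) : Signal :=
  if Qualifies n s t v ∧
      ∀ q : Set.Iic t, (q : Fin n) < t →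
        ¬ Qualifies n s q (fun i => v ⟨i, Set.mem_Iic.2 (le_trans (Set.mem_Iic.1 i.2) (Set.mem_Iic.1 q.2))⟩)
  then Signal.HIRE else Signal.NOT

theorem exp_one_le_of_three_le {n : ℕ} (hn : 3 ≤ n) : Real.exp 1 / n ≤ 1 := by
  have h3 : (3 : ℝ) ≤ n := by exact_mod_cast hn
  rw [div_le_one (by linarith)]
  linarith [Real.exp_one_lt_d9]

/-- The Simple Secretary mechanism: the classic algorithm with sample size `⌊n / e⌋`, run on the
receiver values with probability `e / n` (seed `true`) and on the sender values with probability
`1 - e / n` (seed `false`).  The choice is made once, before the first round. -/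
def simpleSecretary (n : ℕ) (hn : 3 ≤ n) : Mechanism n where
  Seed := Bool
  law b := if b then Real.exp 1 / n else 1 - Real.exp 1 / n
  law_nonneg b := by
    have h := exp_one_le_of_three_le hn
    cases b
    · simpa using h
    · simpa using div_nonneg (Real.exp_pos 1).le (Nat.cast_nonneg n)
  law_sum := by simp
  signal b t x :=
    classicSignal n ⌊(n : ℝ) / Real.exp 1⌋₊ t fun i => if b then (x i).1 else (x i).2

end OnlinePersuasion

end

/-! The signals are determined by the round `T` in which `HIRE` is sent. A receiver who deviates
either lets the `HIRE` signal pass and hires in a later round fixed by `T`, or hires in a fixed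
round before it. With `c` the receiver's best candidate and `π` the arrival order, obedience is
therefore optimal once `P(T = t, π r = c) ≤ P(T = t, π t = c)` for `t < r`, and `P(r < T, π r = c)
≤ P(r < T, π T = c)` for every `r`.

For the classic algorithm with sample size `s` on fixed values, all these probabilities come from
one symmetry: given `π r = c`, the best of the first `k ≤ r` candidates is equally likely to arrive
in each of the first `k` rounds, so with probability `s / k` no candidate qualifies in the rounds
`s, …, k - 1`. Hence `P(T = t, π r = c) = s / n * (1 / t - 1 / (t + 1))` whatever the values, while
`P(T = t, π t = c) = s / (n * t)` if `c` has the largest value. The first inequality holds because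
the algorithm runs on the receiver's values with probability `e / n ≥ 1 / (t + 1)` for `t ≥ s`, and
the second one follows by summing the same comparison over the rounds after `r`; its remainder is
the chance that the algorithm, run on the sender's values, finds `c` in the last round.

The algorithm finds the sender's best candidate with probability `s / n * ∑ 1 / j` over
`s ≤ j < n`, which tends to `-x * log x` if `s / n → x`, and `x = 1 / e` gives `1 / e`.
-/

namespace OnlinePersuasion

section EventWeight

variable {Ω ι : Type*} [Fintype Ω] {w : Ω → ℝ} {E F : Ω → Prop}

open Classical in
/-- The total weight of the outcomes in the event `E`: its probability, if `w` is a probability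
mass function. -/
noncomputable def eventWeight (w : Ω → ℝ) (E : Ω → Prop) : ℝ :=
  ∑ o with E o, w o

theorem eventWeight_nonneg (hw : 0 ≤ w) (E : Ω → Prop) : 0 ≤ eventWeight w E :=
  Finset.sum_nonneg fun o _ => hw o

theorem eventWeight_mono (hw : 0 ≤ w) (h : ∀ o, E o → F o) : eventWeight w E ≤ eventWeight w F :=
  Finset.sum_le_sum_of_subset_of_nonneg (fun o => by simpa using h o) fun o _ _ => hw o

theorem eventWeight_congr (h : ∀ o, E o ↔ F o) : eventWeight w E = eventWeight w F :=
  congrArg _ (funext fun o => propext (h o))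

theorem eventWeight_eq_zero (h : ∀ o, ¬ E o) : eventWeight w E = 0 := by
  simp [eventWeight, h]

theorem eventWeight_and_add_and_not (w : Ω → ℝ) (E F : Ω → Prop) :
    eventWeight w (fun o => E o ∧ F o) + eventWeight w (fun o => E o ∧ ¬ F o) =
      eventWeight w E := by
  classical
  simp only [eventWeight, Finset.sum_filter, ← Finset.sum_add_distrib]
  refine Finset.sum_congr rfl fun o _ => ?_
  by_cases hE : E o <;> by_cases hF : F o <;> simp [hE, hF]

theorem sum_eventWeight_and {S : Finset ι} {A : ι → Ω → Prop}
    (h : ∀ o, E o → ∃! j, j ∈ S ∧ A j o) :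
    ∑ j ∈ S, eventWeight w (fun o => E o ∧ A j o) = eventWeight w E := by
  classical
  simp only [eventWeight, Finset.sum_filter]
  rw [Finset.sum_comm]
  refine Finset.sum_congr rfl fun o _ => ?_
  by_cases hE : E o
  · obtain ⟨j, ⟨hjS, hj⟩, huniq⟩ := h o hE
    rw [Finset.sum_eq_single_of_mem j hjS fun i hi hij => if_neg fun hA => hij (huniq i ⟨hi, hA.2⟩),
      if_pos ⟨hE, hj⟩, if_pos hE]
  · simp [hE]

end EventWeight

section UniformProb

variable {Ω : Type*} [Fintype Ω] {E F : Ω → Prop}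

/-- The probability of `E` under the uniform distribution on a finite type. -/
noncomputable abbrev uniformProb (E : Ω → Prop) : ℝ :=
  eventWeight (fun _ => 1 / (Fintype.card Ω : ℝ)) E

theorem uniformProb_nonneg (E : Ω → Prop) : 0 ≤ uniformProb E :=
  eventWeight_nonneg (fun _ => by positivity) E

theorem uniformProb_mono (h : ∀ o, E o → F o) : uniformProb E ≤ uniformProb F :=
  eventWeight_mono (fun _ => by positivity) h

theorem sum_uniformProb_and {ι : Type*} {S : Finset ι} {A : ι → Ω → Prop}
    (h : ∀ o, E o → ∃! j, j ∈ S ∧ A j o) :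
    ∑ j ∈ S, uniformProb (fun o => E o ∧ A j o) = uniformProb E :=
  sum_eventWeight_and h

theorem uniformProb_true [Nonempty Ω] : uniformProb (fun _ : Ω => True) = 1 := by
  simp [eventWeight]

theorem uniformProb_le_one [Nonempty Ω] (E : Ω → Prop) : uniformProb E ≤ 1 :=
  (uniformProb_mono fun _ _ => trivial).trans uniformProb_true.le

theorem uniformProb_comp_equiv (e : Ω ≃ Ω) (E : Ω → Prop) :
    uniformProb (fun o => E (e o)) = uniformProb E := by
  classical
  simp only [eventWeight, Finset.sum_filter]
  exact e.sum_comp fun o => if E o then 1 / (Fintype.card Ω : ℝ) else 0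

theorem uniformProb_perm_apply_eq {β : Type*} [Fintype β] [DecidableEq β] (a b : β) :
    uniformProb (fun π : Equiv.Perm β => π a = b) = (Fintype.card β : ℝ)⁻¹ := by
  have symmetric : ∀ d, uniformProb (fun π : Equiv.Perm β => π a = d) =
      uniformProb (fun π : Equiv.Perm β => π a = b) := fun d => by
    rw [← uniformProb_comp_equiv (Equiv.mulLeft (Equiv.swap b d)) fun π => π a = d]
    exact eventWeight_congr fun π => by simp [Equiv.swap_apply_eq_iff]
  have total := sum_uniformProb_and (S := Finset.univ) (E := fun _ => True)
    (A := fun d (π : Equiv.Perm β) => π a = d) fun π _ => by simp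
  simp only [true_and, uniformProb_true, symmetric, Finset.sum_const, Finset.card_univ,
    nsmul_eq_mul] at total
  exact eq_inv_of_mul_eq_one_right total

end UniformProb

section BestBefore

variable {n : ℕ} {α : Type*} [LinearOrder α]

/-- Position `j` holds the largest of the first `k` entries of `u`. -/
def IsBestBefore (k : ℕ) (u : Fin n → α) (j : Fin n) : Prop :=
  j.val < k ∧ ∀ i : Fin n, i.val < k → u i ≤ u j

/-- None of the entries of `u` at the positions `s, …, k - 1` exceeds all entries before it. -/
def NoRecord (s k : ℕ) (u : Fin n → α) : Prop :=
  ∀ q : Fin n, s ≤ q.val → q.val < k → ∃ i < q, u q < u i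

variable {s k : ℕ} {u : Fin n → α}

theorem existsUnique_isBestBefore (hu : Function.Injective u) (hn : 0 < n) (hk : 0 < k) :
    ∃! j, IsBestBefore k u j := by
  obtain ⟨j, hj, hmax⟩ := Finset.exists_max_image {i : Fin n | i.val < k} u
    ⟨⟨0, hn⟩, by simpa using hk⟩
  simp only [Finset.mem_filter_univ] at hj hmax
  exact ⟨j, ⟨hj, hmax⟩, fun i hi => hu ((hmax i hi.1).antisymm (hi.2 j hj))⟩

theorem isBestBefore_comp_iff {e : Equiv.Perm (Fin n)} (he : ∀ i, (e i).val < k ↔ i.val < k)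
    {j : Fin n} : IsBestBefore k (u ∘ e) j ↔ IsBestBefore k u (e j) := by
  refine and_congr (he j).symm ⟨fun h i hi => ?_, fun h i hi => h (e i) ((he i).2 hi)⟩
  simpa using h (e.symm i) (by rwa [← he, e.apply_symm_apply])

theorem noRecord_iff_exists_isBestBefore (hu : Function.Injective u) (hn : 0 < n) (hs : 0 < s)
    (hsk : s ≤ k) : NoRecord s k u ↔ ∃ j : Fin n, j.val < s ∧ IsBestBefore k u j := by
  constructor
  · intro h
    obtain ⟨j, hj, -⟩ := existsUnique_isBestBefore hu hn (hs.trans_le hsk)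
    refine ⟨j, ?_, hj⟩
    by_contra! hsj
    obtain ⟨i, hij, hlt⟩ := h j hsj hj.1
    exact (hj.2 i ((Fin.lt_def.1 hij).trans hj.1)).not_gt hlt
  · rintro ⟨j, hjs, -, hmax⟩ q hsq hqk
    have hjq : j < q := hjs.trans_le hsq
    exact ⟨j, hjq, (hmax q hqk).lt_of_ne (hu.ne hjq.ne')⟩

variable {v : Fin n → α} {r : Fin n}

/-- Exchanging two of the first `k` rounds does not affect round `r`. -/
theorem uniformProb_isBestBefore (hv : Function.Injective v) (hkr : k ≤ r.val) (c : Fin n)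
    {j : Fin n} (hj : j.val < k) :
    uniformProb (fun π : Equiv.Perm (Fin n) => π r = c ∧ IsBestBefore k (v ∘ π) j) =
      (n : ℝ)⁻¹ * (k : ℝ)⁻¹ := by
  have symmetric : ∀ l ∈ ({l | l.val < k} : Finset (Fin n)),
      uniformProb (fun π : Equiv.Perm (Fin n) => π r = c ∧ IsBestBefore k (v ∘ π) l) =
        uniformProb (fun π : Equiv.Perm (Fin n) => π r = c ∧ IsBestBefore k (v ∘ π) j) := by
    intro l hl
    rw [Finset.mem_filter_univ] at hl
    rw [← uniformProb_comp_equiv (Equiv.mulRight (Equiv.swap j l))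
      fun π => π r = c ∧ IsBestBefore k (v ∘ π) j]
    have hr : Equiv.swap j l r = r := by
      apply Equiv.swap_apply_of_ne_of_ne <;> rintro rfl <;> omega
    have hprefix : ∀ i, (Equiv.swap j l i).val < k ↔ i.val < k := by grind
    refine eventWeight_congr fun π => ?_
    rw [Equiv.coe_mulRight, Equiv.Perm.mul_apply, hr, Equiv.Perm.coe_mul, ← Function.comp_assoc,
      isBestBefore_comp_iff hprefix, Equiv.swap_apply_left]
  have total := sum_uniformProb_and (S := {l : Fin n | l.val < k})
    (E := fun π : Equiv.Perm (Fin n) => π r = c) (A := fun l π => IsBestBefore k (v ∘ π) l)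
    fun π _ => by
      obtain ⟨l, hl, huniq⟩ :=
        existsUnique_isBestBefore (hv.comp π.injective) r.pos (Nat.zero_lt_of_lt hj)
      exact ⟨l, ⟨by simpa using hl.1, hl⟩, fun i hi => huniq i hi.2⟩
  have hk0 : (k : ℝ) ≠ 0 := Nat.cast_ne_zero.2 (by omega)
  rw [Finset.sum_congr rfl symmetric, uniformProb_perm_apply_eq, Finset.sum_const,
    Fin.card_filter_val_lt, min_eq_right (by omega), nsmul_eq_mul, Fintype.card_fin] at total
  rw [← total]
  field_simp

theorem uniformProb_noRecord (hv : Function.Injective v) (hs : 0 < s) (hsk : s ≤ k)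
    (hkr : k ≤ r.val) (c : Fin n) :
    uniformProb (fun π : Equiv.Perm (Fin n) => π r = c ∧ NoRecord s k (v ∘ π)) =
      s / n * (k : ℝ)⁻¹ := by
  have hnoRecord (π : Equiv.Perm (Fin n)) :=
    noRecord_iff_exists_isBestBefore (hv.comp π.injective) r.pos hs hsk
  rw [← sum_uniformProb_and (S := {l : Fin n | l.val < s})
    (A := fun l (π : Equiv.Perm (Fin n)) => IsBestBefore k (v ∘ π) l)]
  · have hterm : ∀ j ∈ ({l | l.val < s} : Finset (Fin n)),
        uniformProb (fun π : Equiv.Perm (Fin n) =>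
          (π r = c ∧ NoRecord s k (v ∘ π)) ∧ IsBestBefore k (v ∘ π) j) =
            (n : ℝ)⁻¹ * (k : ℝ)⁻¹ := by
      intro j hj
      rw [Finset.mem_filter_univ] at hj
      rw [← uniformProb_isBestBefore hv hkr c (hj.trans_le hsk)]
      refine eventWeight_congr fun π => ⟨fun h => ⟨h.1.1, h.2⟩, fun h => ⟨⟨h.1, ?_⟩, h.2⟩⟩
      exact (hnoRecord π).2 ⟨j, hj, h.2⟩
    rw [Finset.sum_congr rfl hterm, Finset.sum_const, Fin.card_filter_val_lt,
      min_eq_right (by omega), nsmul_eq_mul]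
    ring
  · rintro π ⟨-, h⟩
    obtain ⟨j, hjs, hj⟩ := (hnoRecord π).1 h
    exact ⟨j, ⟨by simpa using hjs, hj⟩, fun i hi =>
      (existsUnique_isBestBefore (hv.comp π.injective) r.pos (by omega)).unique hi.2 hj⟩

end BestBefore

section ClassicAlgorithm

variable {n s : ℕ} {u : Fin n → ℝ} {t : Fin n}

theorem qualifies_iff :
    Qualifies n s t (fun i => u i) ↔ (s ≤ t.val ∧ ∀ i < t, u i < u t) ∨ t.val + 1 = n :=
  or_congr_left <| and_congr_right fun _ =>
    ⟨fun h i hi => h ⟨i, hi.le⟩ hi, fun h i hi => h i hi⟩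

theorem exists_first_qualifies (hn : 0 < n) (s : ℕ) (u : Fin n → ℝ) :
    ∃ t, Qualifies n s t (fun i => u i) ∧ ∀ q < t, ¬ Qualifies n s q (fun i => u i) := by
  obtain ⟨t, ht, hmin⟩ := wellFounded_lt.has_min {t : Fin n | Qualifies n s t fun i => u i}
    ⟨⟨n - 1, by omega⟩, Or.inr (Nat.sub_add_cancel hn)⟩
  exact ⟨t, ht, fun q hqt hq => hmin q hq hqt⟩

/-- The round in which the classic algorithm with sample size `s` hires, if the values arrive in
the order `u`. -/
noncomputable def hireRound (hn : 0 < n) (s : ℕ) (u : Fin n → ℝ) : Fin n :=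
  (exists_first_qualifies hn s u).choose

theorem qualifies_hireRound (hn : 0 < n) (s : ℕ) (u : Fin n → ℝ) :
    Qualifies n s (hireRound hn s u) (fun i => u i) :=
  (exists_first_qualifies hn s u).choose_spec.1

theorem not_qualifies_of_lt_hireRound (hn : 0 < n) (h : t < hireRound hn s u) :
    ¬ Qualifies n s t (fun i => u i) :=
  (exists_first_qualifies hn s u).choose_spec.2 t h

theorem hireRound_eq_iff (hn : 0 < n) :
    hireRound hn s u = t ↔
      Qualifies n s t (fun i => u i) ∧ ∀ q < t, ¬ Qualifies n s q (fun i => u i) := by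
  constructor
  · rintro rfl
    exact ⟨qualifies_hireRound hn s u, fun q hq => not_qualifies_of_lt_hireRound hn hq⟩
  · rintro ⟨ht, hfirst⟩
    exact le_antisymm (not_lt.1 fun h => not_qualifies_of_lt_hireRound hn h ht)
      (not_lt.1 fun h => hfirst _ h (qualifies_hireRound hn s u))

theorem le_hireRound (hn : 0 < n) (hsn : s < n) (u : Fin n → ℝ) :
    s ≤ (hireRound hn s u).val := by
  rcases qualifies_iff.1 (qualifies_hireRound hn s u) with h | h <;> omega

theorem forall_lt_not_qualifies_iff (hu : Function.Injective u) :
    (∀ q < t, ¬ Qualifies n s q (fun i => u i)) ↔ NoRecord s t.val u := by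
  refine forall_congr' fun q => ?_
  rw [qualifies_iff]
  constructor
  · intro h hsq hqt
    by_contra! hrecord
    exact h hqt (Or.inl ⟨hsq, fun i hi => (hrecord i hi).lt_of_ne (hu.ne hi.ne)⟩)
  · rintro h hqt (⟨hsq, hrecord⟩ | hlast)
    · obtain ⟨i, hi, hlt⟩ := h hsq hqt
      exact (hrecord i hi).not_gt hlt
    · omega

theorem noRecord_hireRound (hu : Function.Injective u) (hn : 0 < n) (s : ℕ) :
    NoRecord s (hireRound hn s u).val u :=
  (forall_lt_not_qualifies_iff hu).1 fun _ => not_qualifies_of_lt_hireRound hn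

theorem hireRound_eq_iff_noRecord (hu : Function.Injective u) (hn : 0 < n) :
    hireRound hn s u = t ↔
      ((s ≤ t.val ∧ ∀ i < t, u i < u t) ∨ t.val + 1 = n) ∧ NoRecord s t.val u := by
  rw [hireRound_eq_iff, forall_lt_not_qualifies_iff hu, qualifies_iff]

theorem noRecord_succ_iff (hu : Function.Injective u) (hn : 0 < n) (hst : s ≤ t.val)
    (htn : t.val + 1 < n) :
    NoRecord s (t.val + 1) u ↔ NoRecord s t.val u ∧ hireRound hn s u ≠ t := by
  rw [Ne, hireRound_eq_iff_noRecord hu]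
  constructor
  · refine fun h => ⟨fun q hsq hqt => h q hsq (by omega), ?_⟩
    rintro ⟨⟨-, hrecord⟩ | hlast, -⟩
    · obtain ⟨i, hi, hlt⟩ := h t hst (by omega)
      exact (hrecord i hi).not_gt hlt
    · omega
  · rintro ⟨hprev, hnot⟩ q hsq hqt
    rcases Nat.lt_succ_iff_lt_or_eq.1 hqt with hlt | heq
    · exact hprev q hsq hlt
    · obtain rfl : q = t := Fin.ext heq
      by_contra! hrecord
      exact hnot ⟨Or.inl ⟨hsq, fun i hi => (hrecord i hi).lt_of_ne (hu.ne hi.ne)⟩, hprev⟩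

variable {v : Fin n → ℝ} {r c : Fin n}

theorem uniformProb_hireRound_eq_and_apply_eq (hv : Function.Injective v) (hn : 0 < n)
    (hs : 0 < s) (hst : s ≤ t.val) (hct : (∀ i, v i ≤ v c) ∨ t.val + 1 = n) :
    uniformProb (fun π : Equiv.Perm (Fin n) => hireRound hn s (v ∘ π) = t ∧ π t = c) =
      s / n * (t.val : ℝ)⁻¹ := by
  rw [← uniformProb_noRecord hv hs hst le_rfl c]
  refine eventWeight_congr fun π => ?_
  rw [hireRound_eq_iff_noRecord (hv.comp π.injective)]
  have hqualifies (hπ : π t = c) :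
      (s ≤ t.val ∧ ∀ i < t, (v ∘ π) i < (v ∘ π) t) ∨ t.val + 1 = n :=
    hct.imp_left fun hc => ⟨hst, fun i hi =>
      (hπ ▸ hc (π i)).lt_of_ne ((hv.comp π.injective).ne hi.ne)⟩
  tauto

/-- Hiring in round `t` means that a record-free stretch of rounds ends exactly there. -/
theorem uniformProb_hireRound_eq_and_later (hv : Function.Injective v) (hn : 0 < n)
    (hs : 0 < s) (hst : s ≤ t.val) (htr : t < r) (c : Fin n) :
    uniformProb (fun π : Equiv.Perm (Fin n) => hireRound hn s (v ∘ π) = t ∧ π r = c) =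
      s / n * ((t.val : ℝ)⁻¹ - ((t.val : ℝ) + 1)⁻¹) := by
  have hbefore := uniformProb_noRecord hv hs hst htr.le c
  have hthrough := uniformProb_noRecord hv hs (k := t.val + 1) (by omega) htr c
  have hsplit := eventWeight_and_add_and_not
    (fun _ => 1 / (Fintype.card (Equiv.Perm (Fin n)) : ℝ))
    (fun π : Equiv.Perm (Fin n) => π r = c ∧ NoRecord s t.val (v ∘ π))
    (fun π => hireRound hn s (v ∘ π) = t)
  have hends : uniformProb (fun π : Equiv.Perm (Fin n) => hireRound hn s (v ∘ π) = t ∧ π r = c) =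
      uniformProb (fun π : Equiv.Perm (Fin n) =>
        (π r = c ∧ NoRecord s t.val (v ∘ π)) ∧ hireRound hn s (v ∘ π) = t) :=
    eventWeight_congr fun π => by
      have := fun h => ((hireRound_eq_iff_noRecord (s := s) (t := t)
        (hv.comp π.injective) hn).1 h).2
      tauto
  have hcontinues : uniformProb
      (fun π : Equiv.Perm (Fin n) => π r = c ∧ NoRecord s (t.val + 1) (v ∘ π)) =
      uniformProb (fun π : Equiv.Perm (Fin n) =>
        (π r = c ∧ NoRecord s t.val (v ∘ π)) ∧ ¬ hireRound hn s (v ∘ π) = t) :=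
    eventWeight_congr fun π => by
      rw [noRecord_succ_iff (hv.comp π.injective) hn hst (by omega), and_assoc]
  push_cast at hthrough
  rw [mul_sub, ← hbefore, ← hthrough, hends, hcontinues]
  exact eq_sub_of_add_eq hsplit

theorem uniformProb_hireRound_best_from (hv : Function.Injective v) (hc : ∀ i, v i ≤ v c)
    (hn : 0 < n) (hs : 0 < s) {k : ℕ} (hsk : s ≤ k) :
    uniformProb (fun π : Equiv.Perm (Fin n) =>
        k ≤ (hireRound hn s (v ∘ π)).val ∧ π (hireRound hn s (v ∘ π)) = c) =
      s / n * ∑ j ∈ Finset.Ico k n, (j : ℝ)⁻¹ := by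
  rw [← sum_uniformProb_and (S := {t : Fin n | k ≤ t.val})
    (A := fun t (π : Equiv.Perm (Fin n)) => hireRound hn s (v ∘ π) = t)
    fun π h => ⟨_, ⟨by simpa using h.1, rfl⟩, fun _ h => h.2.symm⟩]
  have hterm : ∀ t ∈ ({t | k ≤ t.val} : Finset (Fin n)),
      uniformProb (fun π : Equiv.Perm (Fin n) =>
        (k ≤ (hireRound hn s (v ∘ π)).val ∧ π (hireRound hn s (v ∘ π)) = c) ∧
          hireRound hn s (v ∘ π) = t) = s / n * (t.val : ℝ)⁻¹ := by
    intro t ht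
    rw [Finset.mem_filter_univ] at ht
    rw [← uniformProb_hireRound_eq_and_apply_eq hv hn hs (hsk.trans ht) (Or.inl hc)]
    refine eventWeight_congr fun π => ⟨?_, ?_⟩
    · rintro ⟨⟨-, hπ⟩, rfl⟩
      exact ⟨rfl, hπ⟩
    · rintro ⟨rfl, hπ⟩
      exact ⟨⟨ht, hπ⟩, rfl⟩
  rw [Finset.sum_congr rfl hterm, ← Finset.mul_sum, Finset.sum_filter,
    Fin.sum_univ_eq_sum_range (fun j => if k ≤ j then (j : ℝ)⁻¹ else 0), ← Finset.sum_filter,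
    Finset.range_eq_Ico, Finset.Ico_filter_le, max_eq_right (Nat.zero_le k)]

end ClassicAlgorithm

section Mixture

variable {n s : ℕ} {p : ℝ} {v w : Fin n → ℝ}

/-- The probability of the event `E π T` for the arrival order `π` and the hiring round `T` of the
classic algorithm, when the algorithm runs on the values `v` with probability `p` and on the values
`w` with probability `1 - p`, independently of `π`. -/
noncomputable def mixProb (hn : 0 < n) (s : ℕ) (p : ℝ) (v w : Fin n → ℝ)
    (E : Equiv.Perm (Fin n) → Fin n → Prop) : ℝ :=
  p * uniformProb (fun π : Equiv.Perm (Fin n) => E π (hireRound hn s (v ∘ π))) +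
    (1 - p) * uniformProb (fun π : Equiv.Perm (Fin n) => E π (hireRound hn s (w ∘ π)))

theorem mixProb_nonneg (hn : 0 < n) (hp0 : 0 ≤ p) (hp1 : p ≤ 1)
    (E : Equiv.Perm (Fin n) → Fin n → Prop) : 0 ≤ mixProb hn s p v w E :=
  add_nonneg (mul_nonneg hp0 (uniformProb_nonneg _))
    (mul_nonneg (sub_nonneg.2 hp1) (uniformProb_nonneg _))

theorem mixProb_eq_zero (hn : 0 < n) {E : Equiv.Perm (Fin n) → Fin n → Prop}
    (h : ∀ (u : Fin n → ℝ) π, ¬ E π (hireRound hn s u)) : mixProb hn s p v w E = 0 := by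
  have hzero (u : Fin n → ℝ) :
      uniformProb (fun π : Equiv.Perm (Fin n) => E π (hireRound hn s (u ∘ π))) = 0 :=
    eventWeight_eq_zero fun π => h _ π
  rw [mixProb, hzero, hzero, mul_zero, mul_zero, add_zero]

variable {c r : Fin n}

/-- Round `t` is better than round `r` by a factor `t + 1` if the algorithm runs on `v`, which
happens with probability `p ≥ 1 / (t + 1)`. -/
theorem mixProb_later_le_now (hn : 0 < n) (hs : 0 < s) (hv : Function.Injective v)
    (hw : Function.Injective w) (hc : ∀ i, v i ≤ v c) (hp1 : p ≤ 1) {t : Fin n}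
    (hst : s ≤ t.val) (hpt : 1 ≤ p * (t.val + 1)) (htr : t < r) :
    mixProb hn s p v w (fun π T => T = t ∧ π r = c) ≤
      mixProb hn s p v w (fun π T => T = t ∧ π t = c) := by
  have ht0 : (0 : ℝ) < t.val := Nat.cast_pos.2 (hs.trans_le hst)
  have hw_now := mul_nonneg (sub_nonneg.2 hp1)
    (uniformProb_nonneg fun π : Equiv.Perm (Fin n) => hireRound hn s (w ∘ π) = t ∧ π t = c)
  have hfactor : (t.val : ℝ)⁻¹ - ((t.val : ℝ) + 1)⁻¹ ≤ p * (t.val : ℝ)⁻¹ := by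
    rw [inv_sub_inv ht0.ne' (by positivity), add_sub_cancel_left, ← div_eq_mul_inv,
      div_le_div_iff₀ (by positivity) ht0]
    nlinarith
  calc mixProb hn s p v w (fun π T => T = t ∧ π r = c)
      = s / n * ((t.val : ℝ)⁻¹ - ((t.val : ℝ) + 1)⁻¹) := by
        rw [mixProb, uniformProb_hireRound_eq_and_later hv hn hs hst htr,
          uniformProb_hireRound_eq_and_later hw hn hs hst htr]
        ring
    _ ≤ s / n * (p * (t.val : ℝ)⁻¹) := by gcongr
    _ ≤ mixProb hn s p v w (fun π T => T = t ∧ π t = c) := by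
        rw [mixProb, uniformProb_hireRound_eq_and_apply_eq hv hn hs hst (Or.inl hc)]
        linarith

/-- Besides hiring the best candidate with the values `v`, the mixture may find it in the last
round with the values `w`. -/
theorem le_mixProb_hireRound_best (hn : 0 < n) (hs : 0 < s) (hsn : s < n)
    (hv : Function.Injective v) (hw : Function.Injective w) (hc : ∀ i, v i ≤ v c) (hp0 : 0 ≤ p)
    (hp1 : p ≤ 1) {k : ℕ} (hsk : s ≤ k) (hrk : r.val < k) (hrn : r.val + 1 < n) :
    s / n * (p * ∑ j ∈ Finset.Ico k n, (j : ℝ)⁻¹ + (1 - p) * ((n - 1 : ℕ) : ℝ)⁻¹) ≤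
      mixProb hn s p v w (fun π T => r < T ∧ π T = c) := by
  let last : Fin n := ⟨n - 1, by omega⟩
  have hv_part : s / n * ∑ j ∈ Finset.Ico k n, (j : ℝ)⁻¹ ≤ uniformProb fun π : Equiv.Perm (Fin n) =>
      r < hireRound hn s (v ∘ π) ∧ π (hireRound hn s (v ∘ π)) = c := by
    rw [← uniformProb_hireRound_best_from hv hc hn hs hsk]
    exact uniformProb_mono fun π h => ⟨hrk.trans_le h.1, h.2⟩
  have hw_part : s / n * ((n - 1 : ℕ) : ℝ)⁻¹ ≤ uniformProb fun π : Equiv.Perm (Fin n) =>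
      r < hireRound hn s (w ∘ π) ∧ π (hireRound hn s (w ∘ π)) = c := by
    have hlast := uniformProb_hireRound_eq_and_apply_eq (c := c) (t := last) hw hn hs
      (Nat.le_sub_one_of_lt hsn) (Or.inr (Nat.sub_add_cancel hn))
    refine hlast.ge.trans (uniformProb_mono fun π h => ?_)
    rw [h.1]
    exact ⟨Nat.lt_sub_of_add_lt hrn, h.2⟩
  rw [mixProb, mul_add, mul_left_comm, mul_left_comm _ (1 - p)]
  exact add_le_add (mul_le_mul_of_nonneg_left hv_part hp0)
    (mul_le_mul_of_nonneg_left hw_part (sub_nonneg.2 hp1))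

theorem mixProb_reject_le_inv (hn : 0 < n) (hp0 : 0 ≤ p) (hp1 : p ≤ 1) :
    mixProb hn s p v w (fun π T => r < T ∧ π r = c) ≤ (n : ℝ)⁻¹ := by
  have hle (u : Fin n → ℝ) : uniformProb (fun π : Equiv.Perm (Fin n) =>
      r < hireRound hn s (u ∘ π) ∧ π r = c) ≤ (n : ℝ)⁻¹ := by
    refine (uniformProb_mono fun π h => h.2).trans_eq ?_
    rw [uniformProb_perm_apply_eq, Fintype.card_fin]
  refine (add_le_add (mul_le_mul_of_nonneg_left (hle v) hp0)
    (mul_le_mul_of_nonneg_left (hle w) (sub_nonneg.2 hp1))).trans_eq ?_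
  ring

theorem mixProb_reject_le_of_le (hn : 0 < n) (hs : 0 < s) (hv : Function.Injective v)
    (hw : Function.Injective w) (hc : ∀ i, v i ≤ v c) (hp1 : p ≤ 1) (hsr : s ≤ r.val) :
    mixProb hn s p v w (fun π T => r < T ∧ π r = c) ≤ s / n * ((1 - p) * (r.val : ℝ)⁻¹) := by
  have hv_part : uniformProb (fun π : Equiv.Perm (Fin n) =>
      r < hireRound hn s (v ∘ π) ∧ π r = c) = 0 := by
    refine eventWeight_eq_zero ?_
    rintro π ⟨hlt, rfl⟩
    obtain ⟨i, -, hi⟩ := noRecord_hireRound (hv.comp π.injective) hn s r hsr hlt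
    exact (hc (π i)).not_gt hi
  have hw_part : uniformProb (fun π : Equiv.Perm (Fin n) =>
      r < hireRound hn s (w ∘ π) ∧ π r = c) ≤ s / n * (r.val : ℝ)⁻¹ := by
    rw [← uniformProb_noRecord hw hs hsr le_rfl c]
    exact uniformProb_mono fun π h => ⟨h.2, fun q hsq hqr =>
      noRecord_hireRound (hw.comp π.injective) hn s q hsq (hqr.trans h.1)⟩
  rw [mixProb, hv_part, mul_zero, zero_add, mul_left_comm]
  exact mul_le_mul_of_nonneg_left hw_part (sub_nonneg.2 hp1)

theorem one_sub_mul_inv_le_mul_sum_inv_add {k m : ℕ} (hk : 0 < k)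
    (hp : ∀ j : ℕ, k < j → 1 ≤ p * j) (hkm : k ≤ m) :
    (1 - p) * (k : ℝ)⁻¹ ≤
      p * ∑ j ∈ Finset.Ico (k + 1) (m + 1), (j : ℝ)⁻¹ + (1 - p) * (m : ℝ)⁻¹ := by
  induction m, hkm using Nat.le_induction with
  | base => simp
  | succ m hkm ih =>
    rw [Finset.sum_Ico_succ_top (by omega)]
    have hm0 : (0 : ℝ) < m := Nat.cast_pos.2 (hk.trans_le hkm)
    have hpm := hp (m + 1) (by omega)
    push_cast at hpm ⊢
    have hstep : (1 - p) * (m : ℝ)⁻¹ ≤ ((m : ℝ) + 1)⁻¹ := by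
      rw [← div_eq_mul_inv, inv_eq_one_div, div_le_div_iff₀ hm0 (by positivity)]
      linarith
    linarith

theorem mixProb_reject_le_hireRound (hn : 0 < n) (hs : 0 < s) (hsn : s < n)
    (hv : Function.Injective v) (hw : Function.Injective w) (hc : ∀ i, v i ≤ v c) (hp0 : 0 ≤ p)
    (hp1 : p ≤ 1) (hp : ∀ j : ℕ, s < j → 1 ≤ p * j) (r : Fin n) :
    mixProb hn s p v w (fun π T => r < T ∧ π r = c) ≤
      mixProb hn s p v w (fun π T => r < T ∧ π T = c) := by
  rcases le_or_gt n (r.val + 1) with hlast | hrn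
  · rw [mixProb_eq_zero hn fun u π h => by omega]
    exact mixProb_nonneg hn hp0 hp1 _
  have hcompensate (k : ℕ) (hsk : s ≤ k) (hkn : k < n) : (1 - p) * (k : ℝ)⁻¹ ≤
      p * ∑ j ∈ Finset.Ico (k + 1) n, (j : ℝ)⁻¹ + (1 - p) * ((n - 1 : ℕ) : ℝ)⁻¹ := by
    simpa only [Nat.sub_add_cancel hn] using one_sub_mul_inv_le_mul_sum_inv_add
      (hs.trans_le hsk) (fun j hj => hp j (hsk.trans_lt hj)) (Nat.le_sub_one_of_lt hkn)
  rcases lt_or_ge r.val s with hrs | hsr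
  · have hs0 : (s : ℝ) ≠ 0 := Nat.cast_ne_zero.2 hs.ne'
    calc mixProb hn s p v w (fun π T => r < T ∧ π r = c)
        ≤ (n : ℝ)⁻¹ := mixProb_reject_le_inv hn hp0 hp1
      _ = s / n * (p * (s : ℝ)⁻¹ + (1 - p) * (s : ℝ)⁻¹) := by field_simp; ring
      _ ≤ s / n * (p * (s : ℝ)⁻¹ + (p * ∑ j ∈ Finset.Ico (s + 1) n, (j : ℝ)⁻¹ +
            (1 - p) * ((n - 1 : ℕ) : ℝ)⁻¹)) := by
          gcongr
          exact hcompensate s le_rfl hsn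
      _ = s / n * (p * ∑ j ∈ Finset.Ico s n, (j : ℝ)⁻¹ + (1 - p) * ((n - 1 : ℕ) : ℝ)⁻¹) := by
          rw [Finset.sum_eq_sum_Ico_succ_bot hsn]
          ring
      _ ≤ _ := le_mixProb_hireRound_best hn hs hsn hv hw hc hp0 hp1 le_rfl hrs hrn
  · calc mixProb hn s p v w (fun π T => r < T ∧ π r = c)
        ≤ s / n * ((1 - p) * (r.val : ℝ)⁻¹) := mixProb_reject_le_of_le hn hs hv hw hc hp1 hsr
      _ ≤ s / n * (p * ∑ j ∈ Finset.Ico (r.val + 1) n, (j : ℝ)⁻¹ +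
            (1 - p) * ((n - 1 : ℕ) : ℝ)⁻¹) := by
          gcongr
          exact hcompensate r hsr r.isLt
      _ ≤ _ := le_mixProb_hireRound_best hn hs hsn hv hw hc hp0 hp1 (by omega)
          (Nat.lt_succ_self _) hrn

end Mixture


section SingleHire

variable {n t : ℕ} {d : Strategy n} {r τ : Fin n}

open Classical in
/-- The signals of a mechanism that signals `HIRE` exactly in round `τ`. -/
noncomputable def singleHire (τ : Fin n) : Fin n → Signal :=
  fun i => if i = τ then Signal.HIRE else Signal.NOT

theorem singleHire_eq_hire : singleHire τ r = Signal.HIRE ↔ r = τ := by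
  simp [singleHire]

theorem singleHire_eq_not : singleHire τ r = Signal.NOT ↔ r ≠ τ := by
  simp [singleHire]

theorem hiresAt_unique {σ : Fin n → Signal} {r' : Fin n} (h : HiresAt d σ t r)
    (h' : HiresAt d σ t r') : r = r' :=
  le_antisymm (not_lt.1 fun hlt => h.2.2 r' h'.1 hlt h'.2.1)
    (not_lt.1 fun hlt => h'.2.2 r h.1 hlt h.2.1)

theorem hiresAt_obedient_singleHire (ht : t ≤ τ.val) :
    HiresAt (obedient n) (singleHire τ) t r ↔ r = τ := by
  simp only [HiresAt, obedient, singleHire_eq_hire]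
  constructor
  · exact fun h => h.2.1
  · rintro rfl
    exact ⟨ht, rfl, fun q _ hq => hq.ne⟩

theorem hiresAt_singleHire_iff_of_lt (h : r < τ) :
    HiresAt d (singleHire τ) t r ↔ HiresAt d (fun _ => Signal.NOT) t r := by
  have hsignals {q : Fin n} (hq : q ≤ r) :
      (fun i : Set.Iic q => singleHire τ i) = fun _ => Signal.NOT :=
    funext fun i => singleHire_eq_not.2 ((i.2.trans hq).trans_lt h).ne
  unfold HiresAt
  rw [hsignals le_rfl]
  refine and_congr_right fun _ => and_congr_right fun _ => forall_congr' fun q =>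
    forall_congr' fun _ => forall_congr' fun hq => ?_
  rw [hsignals hq.le]

end SingleHire

namespace Mechanism

section Obedience

variable {n : ℕ} {M : Mechanism n} {I : Instance n} {T : M.Outcome → Fin n} {c t : Fin n}
  {d : Strategy n}

theorem weight_nonneg (M : Mechanism n) : 0 ≤ M.weight :=
  fun o => mul_nonneg (by positivity) (M.law_nonneg o.2)

theorem prob_eq_eventWeight (E : M.Outcome → Prop) : M.prob E = eventWeight M.weight E := by
  simp [prob, expect, eventWeight, Finset.sum_filter]

theorem receiverSuccess_iff (hc : ∀ i, I.IsReceiverBest i ↔ i = c)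
    (hT : ∀ o, M.signals I o = singleHire (T o)) {t : ℕ} {o : M.Outcome} :
    M.ReceiverSuccess I d t o ↔ ∃ r, HiresAt d (singleHire (T o)) t r ∧ o.1 r = c := by
  simp only [ReceiverSuccess, hT, hc]

theorem receiverSuccess_obedient_iff (hc : ∀ i, I.IsReceiverBest i ↔ i = c)
    (hT : ∀ o, M.signals I o = singleHire (T o)) {t : ℕ} {o : M.Outcome} (ht : t ≤ (T o).val) :
    M.ReceiverSuccess I (obedient n) t o ↔ o.1 (T o) = c := by
  simp only [receiverSuccess_iff hc hT, hiresAt_obedient_singleHire ht, exists_eq_left]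

/-- A receiver who does not hire before the `HIRE` signal hires in its round `τ` or in a later round
that depends only on `τ`. -/
theorem prob_receiverSuccess_le_of_waits (hc : ∀ i, I.IsReceiverBest i ↔ i = c)
    (hT : ∀ o, M.signals I o = singleHire (T o))
    (hire : ∀ τ r, τ < r →
      M.prob (fun o => T o = τ ∧ o.1 r = c) ≤ M.prob (fun o => T o = τ ∧ o.1 τ = c))
    {t : ℕ} {A : Fin n → Prop} (hA : ∀ τ, A τ → ∀ r < τ, ¬ HiresAt d (fun _ => Signal.NOT) t r) :
    M.prob (fun o => A (T o) ∧ M.ReceiverSuccess I d t o) ≤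
      M.prob (fun o => A (T o) ∧ o.1 (T o) = c) := by
  simp only [prob_eq_eventWeight, receiverSuccess_iff hc hT] at hire ⊢
  rw [← sum_eventWeight_and (S := Finset.univ) (A := fun τ o => T o = τ) fun o _ => by simp,
    ← sum_eventWeight_and (S := Finset.univ) (A := fun τ o => T o = τ) fun o _ => by simp]
  refine Finset.sum_le_sum fun τ _ => ?_
  by_cases h : A τ ∧ ∃ r, HiresAt d (singleHire τ) t r
  · obtain ⟨hτ, r, hr⟩ := h
    have hτr : τ ≤ r :=
      not_lt.1 fun hlt => hA τ hτ r hlt ((hiresAt_singleHire_iff_of_lt hlt).1 hr)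
    have hcurrent : eventWeight M.weight (fun o => T o = τ ∧ o.1 r = c) ≤
        eventWeight M.weight (fun o => T o = τ ∧ o.1 τ = c) := by
      rcases hτr.eq_or_lt with rfl | hlt
      · exact le_rfl
      · exact hire τ r hlt
    refine (eventWeight_mono M.weight_nonneg ?_).trans
      (hcurrent.trans (eventWeight_mono M.weight_nonneg ?_))
    · rintro o ⟨⟨-, r', hr', hbest⟩, rfl⟩
      exact ⟨rfl, hiresAt_unique hr hr' ▸ hbest⟩
    · rintro o ⟨rfl, hbest⟩
      exact ⟨⟨hτ, hbest⟩, rfl⟩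
  · rw [eventWeight_eq_zero]
    · exact eventWeight_nonneg M.weight_nonneg _
    · rintro o ⟨⟨hτ, r, hr, -⟩, rfl⟩
      exact h ⟨hτ, r, hr⟩

/-- If the receiver sees only `NOT`, she hires in a fixed round `r`, so she deviates only through
hiring in round `r` when the `HIRE` signal comes later. -/
theorem prob_receiverSuccess_le_of_lt (hc : ∀ i, I.IsReceiverBest i ↔ i = c)
    (hT : ∀ o, M.signals I o = singleHire (T o))
    (hire : ∀ τ r, τ < r →
      M.prob (fun o => T o = τ ∧ o.1 r = c) ≤ M.prob (fun o => T o = τ ∧ o.1 τ = c))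
    (wait : ∀ r, M.prob (fun o => r < T o ∧ o.1 r = c) ≤
      M.prob (fun o => r < T o ∧ o.1 (T o) = c)) :
    M.prob (fun o => t < T o ∧ M.ReceiverSuccess I d t o) ≤
      M.prob (fun o => t < T o ∧ o.1 (T o) = c) := by
  by_cases hr : ∃ r, HiresAt d (fun _ => Signal.NOT) t r
  · obtain ⟨r, hr⟩ := hr
    have hearly : M.prob (fun o => (t < T o ∧ M.ReceiverSuccess I d t o) ∧ r < T o) ≤
        M.prob (fun o => (t < T o ∧ o.1 (T o) = c) ∧ r < T o) := by
      simp only [prob_eq_eventWeight, receiverSuccess_iff hc hT] at wait ⊢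
      refine (eventWeight_mono M.weight_nonneg ?_).trans
        ((wait r).trans (eventWeight_mono M.weight_nonneg ?_))
      · rintro o ⟨⟨-, r', hr', hbest⟩, hlt⟩
        exact ⟨hlt, hiresAt_unique ((hiresAt_singleHire_iff_of_lt hlt).2 hr) hr' ▸ hbest⟩
      · exact fun o ho => ⟨⟨(Fin.le_def.2 hr.1).trans_lt ho.1, ho.2⟩, ho.1⟩
    have hpatient := prob_receiverSuccess_le_of_waits (A := fun τ => t < τ ∧ ¬ r < τ) (d := d)
      (t := t) hc hT hire fun τ hτ r' hr'τ hr' => hτ.2 (hiresAt_unique hr hr' ▸ hr'τ)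
    simp only [and_right_comm (b := ¬ _)] at hpatient
    simp only [prob_eq_eventWeight] at hearly hpatient ⊢
    rw [← eventWeight_and_add_and_not _ _ fun o => r < T o,
      ← eventWeight_and_add_and_not _ (fun o => t < T o ∧ o.1 (T o) = c) fun o => r < T o]
    exact add_le_add hearly hpatient
  · exact prob_receiverSuccess_le_of_waits (A := fun τ => t < τ) hc hT hire
      fun τ _ r _ h => hr ⟨r, h⟩

variable {h : Set.Iic t → Signal} {o : M.Outcome}

theorem historyIs_iff_of_hire (hT : ∀ o, M.signals I o = singleHire (T o))
    (hnot : ∀ i : Set.Iic t, (i : Fin n) < t → h i = Signal.NOT)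
    (hh : h ⟨t, Set.mem_Iic.2 le_rfl⟩ = Signal.HIRE) : M.HistoryIs I t h o ↔ T o = t := by
  unfold HistoryIs
  rw [hT]
  constructor
  · exact fun hi => (singleHire_eq_hire.1 ((hi ⟨t, Set.mem_Iic.2 le_rfl⟩).trans hh)).symm
  · rintro rfl ⟨i, hi⟩
    rcases (Set.mem_Iic.1 hi).eq_or_lt with rfl | hlt
    · exact (singleHire_eq_hire.2 rfl).trans hh.symm
    · exact (singleHire_eq_not.2 hlt.ne).trans (hnot ⟨i, hi⟩ hlt).symm

theorem historyIs_iff_of_not (hT : ∀ o, M.signals I o = singleHire (T o))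
    (hnot : ∀ i, h i = Signal.NOT) : M.HistoryIs I t h o ↔ t < T o := by
  simp only [HistoryIs, hT, hnot, singleHire_eq_not]
  constructor
  · exact fun hi => not_le.1 fun hle => hi ⟨T o, hle⟩ rfl
  · exact fun hlt i => (i.2.trans_lt hlt).ne

theorem condProb_receiverSuccess_le_obedient (hc : ∀ i, I.IsReceiverBest i ↔ i = c)
    (hT : ∀ o, M.signals I o = singleHire (T o))
    (hire : ∀ τ r, τ < r →
      M.prob (fun o => T o = τ ∧ o.1 r = c) ≤ M.prob (fun o => T o = τ ∧ o.1 τ = c))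
    (wait : ∀ r, M.prob (fun o => r < T o ∧ o.1 r = c) ≤
      M.prob (fun o => r < T o ∧ o.1 (T o) = c))
    (hnot : ∀ i : Set.Iic t, (i : Fin n) < t → h i = Signal.NOT) (d : Strategy n) :
    M.condProb (M.ReceiverSuccess I d t) (M.HistoryIs I t h) ≤
      M.condProb (M.ReceiverSuccess I (obedient n) t) (M.HistoryIs I t h) := by
  obtain ⟨A, hhistory, htA, hle⟩ : ∃ A : Fin n → Prop, (∀ o, M.HistoryIs I t h o ↔ A (T o)) ∧
      (∀ τ, A τ → t ≤ τ) ∧ M.prob (fun o => A (T o) ∧ M.ReceiverSuccess I d t o) ≤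
        M.prob (fun o => A (T o) ∧ o.1 (T o) = c) := by
    cases hh : h ⟨t, Set.mem_Iic.2 le_rfl⟩ with
    | HIRE =>
      refine ⟨(· = t), fun o => historyIs_iff_of_hire hT hnot hh, fun τ hτ => hτ.ge,
        prob_receiverSuccess_le_of_waits (A := (· = t)) hc hT hire ?_⟩
      rintro τ rfl r hr hhires
      exact hhires.1.not_gt hr
    | NOT =>
      have hall (i : Set.Iic t) : h i = Signal.NOT := by
        rcases (Set.mem_Iic.1 i.2).eq_or_lt with heq | hlt
        · rwa [← Subtype.ext (a2 := ⟨t, Set.mem_Iic.2 le_rfl⟩) heq] at hh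
        · exact hnot i hlt
      exact ⟨(t < ·), fun o => historyIs_iff_of_not hT hall, fun τ hτ => hτ.le,
        prob_receiverSuccess_le_of_lt hc hT hire wait⟩
  have hobedient (o : M.Outcome) : M.ReceiverSuccess I (obedient n) t o ∧ A (T o) ↔
      A (T o) ∧ o.1 (T o) = c := by
    rw [and_comm]
    exact and_congr_right fun ho => receiverSuccess_obedient_iff hc hT (htA _ ho)
  simp only [condProb, hhistory, hobedient, and_comm (b := A _)]
  refine div_le_div_of_nonneg_right hle ?_
  rw [prob_eq_eventWeight]
  exact eventWeight_nonneg M.weight_nonneg _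

end Obedience

end Mechanism

section SimpleSecretary

variable {n : ℕ}

theorem Mechanism.prob_eq_sum_uniformProb {M : Mechanism n} (E : M.Outcome → Prop) :
    M.prob E = ∑ b, M.law b * uniformProb fun π => E (π, b) := by
  classical
  simp only [prob_eq_eventWeight, eventWeight, Finset.sum_filter, Fintype.sum_prod_type_right,
    Finset.mul_sum, weight, Fintype.card_perm, Fintype.card_fin]
  refine Finset.sum_congr rfl fun b _ => Finset.sum_congr rfl fun π _ => ?_
  rw [mul_ite, mul_zero, mul_comm]

/-- The number `⌊n / e⌋` of rounds which the Simple Secretary mechanism uses as a sample. -/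
noncomputable def sampleSize (n : ℕ) : ℕ := ⌊(n : ℝ) / Real.exp 1⌋₊

theorem sampleSize_pos (hn : 3 ≤ n) : 0 < sampleSize n := by
  have h3 : (3 : ℝ) ≤ n := by exact_mod_cast hn
  rw [sampleSize, Nat.floor_pos, one_le_div (Real.exp_pos 1)]
  linarith [Real.exp_one_lt_d9]

theorem sampleSize_lt (hn : 0 < n) : sampleSize n < n := by
  rw [sampleSize, Nat.floor_lt (by positivity)]
  exact div_lt_self (Nat.cast_pos.2 hn) (Real.one_lt_exp_iff.2 one_pos)

theorem one_le_exp_div_mul {j : ℕ} (hn : 0 < n) (hj : sampleSize n < j) :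
    1 ≤ Real.exp 1 / n * j := by
  rw [sampleSize, Nat.floor_lt (by positivity), div_lt_iff₀' (Real.exp_pos 1)] at hj
  rw [div_mul_eq_mul_div, one_le_div (Nat.cast_pos.2 hn)]
  exact hj.le

theorem classicSignal_eq_singleHire (hn : 0 < n) (s : ℕ) (u : Fin n → ℝ) (t : Fin n) :
    classicSignal n s t (fun i => u i) = singleHire (hireRound hn s u) t := by
  classical
  unfold classicSignal singleHire
  refine if_congr ?_ rfl rfl
  rw [eq_comm (a := t), hireRound_eq_iff]
  exact and_congr_right fun _ => ⟨fun h q hq => h ⟨q, hq.le⟩ hq, fun h q hq => h q hq⟩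

/-- The candidates' values which the Simple Secretary mechanism uses with the given seed. -/
def Instance.value (I : Instance n) (b : Bool) : Fin n → ℝ := if b then I.ρ else I.ξ

/-- The round in which the Simple Secretary mechanism signals `HIRE`. -/
noncomputable def secretaryRound (hn : 3 ≤ n) (I : Instance n)
    (o : (simpleSecretary n hn).Outcome) : Fin n :=
  hireRound (Nat.zero_lt_of_lt hn) (sampleSize n) (I.value o.2 ∘ o.1)

theorem simpleSecretary_signals (hn : 3 ≤ n) (I : Instance n)
    (o : (simpleSecretary n hn).Outcome) :
    (simpleSecretary n hn).signals I o = singleHire (secretaryRound hn I o) := by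
  obtain ⟨π, b⟩ := o
  funext t
  rw [secretaryRound, ← classicSignal_eq_singleHire]
  cases b <;> rfl

theorem simpleSecretary_prob (hn : 3 ≤ n) (I : Instance n)
    (E : Equiv.Perm (Fin n) → Fin n → Prop) :
    (simpleSecretary n hn).prob (fun o => E o.1 (secretaryRound hn I o)) =
      mixProb (Nat.zero_lt_of_lt hn) (sampleSize n) (Real.exp 1 / n) I.ρ I.ξ E :=
  (Mechanism.prob_eq_sum_uniformProb _).trans (Fintype.sum_bool _)

theorem simpleSecretary_persuasive (hn : 3 ≤ n) : (simpleSecretary n hn).Persuasive := by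
  intro I t h hnot _ d
  have : Nonempty (Fin n) := ⟨t⟩
  obtain ⟨c, hc⟩ := Finite.exists_max I.ρ
  have hn0 : 0 < n := t.pos
  have hs := sampleSize_pos hn
  have hsn := sampleSize_lt hn0
  have hp0 : 0 ≤ Real.exp 1 / n := by positivity
  have hp1 := exp_one_le_of_three_le hn
  refine Mechanism.condProb_receiverSuccess_le_obedient
    (fun i => ⟨fun hi => I.ρ_injective ((hc i).antisymm (hi c)), fun hi => hi ▸ hc⟩)
    (simpleSecretary_signals hn I) (fun τ r hτr => ?_) (fun r => ?_) hnot d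
  · rw [simpleSecretary_prob hn I fun π T => T = τ ∧ π r = c,
      simpleSecretary_prob hn I fun π T => T = τ ∧ π τ = c]
    rcases lt_or_ge τ.val (sampleSize n) with hτ | hτ
    · rw [mixProb_eq_zero hn0]
      · exact mixProb_nonneg hn0 hp0 hp1 _
      · rintro u π ⟨rfl, -⟩
        exact (le_hireRound hn0 hsn u).not_gt hτ
    · refine mixProb_later_le_now hn0 hs I.ρ_injective I.ξ_injective hc hp1 hτ ?_ hτr
      exact_mod_cast one_le_exp_div_mul hn0 (Nat.lt_succ_of_le hτ)
  · rw [simpleSecretary_prob hn I fun π T => r < T ∧ π r = c,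
      simpleSecretary_prob hn I fun π T => r < T ∧ π T = c]
    exact mixProb_reject_le_hireRound hn0 hs hsn I.ρ_injective I.ξ_injective hc hp0 hp1
      (fun j => one_le_exp_div_mul hn0) r

end SimpleSecretary

section Asymptotics

/-- The probability that the classic algorithm with sample size `s` hires the best of `n`
candidates. -/
noncomputable def classicSuccess (n s : ℕ) : ℝ := s / n * ∑ j ∈ Finset.Ico s n, (j : ℝ)⁻¹

theorem uniformProb_hireRound_best {n s : ℕ} {v : Fin n → ℝ} {c : Fin n}
    (hv : Function.Injective v) (hc : ∀ i, v i ≤ v c) (hn : 0 < n) (hs : 0 < s) (hsn : s < n) :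
    uniformProb (fun π : Equiv.Perm (Fin n) => π (hireRound hn s (v ∘ π)) = c) =
      classicSuccess n s := by
  rw [classicSuccess, ← uniformProb_hireRound_best_from hv hc hn hs le_rfl]
  exact eventWeight_congr fun π => (and_iff_right (le_hireRound hn hsn _)).symm

theorem sum_Ico_inv_eq_harmonic {k m : ℕ} (hkm : k ≤ m) :
    ∑ j ∈ Finset.Ico k m, (j : ℝ)⁻¹ = harmonic m - harmonic k + ((k : ℝ)⁻¹ - (m : ℝ)⁻¹) := by
  induction m, hkm using Nat.le_induction with
  | base => simp
  | succ m hkm ih =>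
    rw [Finset.sum_Ico_succ_top hkm, ih, harmonic_succ]
    push_cast
    ring

theorem tendsto_sum_Ico_inv {a : ℕ → ℕ} {x : ℝ} (hx : 0 < x) (ha : ∀ᶠ n in atTop, a n ≤ n)
    (hax : Tendsto (fun n => (a n : ℝ) / n) atTop (𝓝 x)) :
    Tendsto (fun n => ∑ j ∈ Finset.Ico (a n) n, (j : ℝ)⁻¹) atTop (𝓝 (-Real.log x)) := by
  have ha_top : Tendsto a atTop atTop := by
    have hmul := hax.pos_mul_atTop hx tendsto_natCast_atTop_atTop
    refine tendsto_natCast_atTop_iff.1 (hmul.congr' ?_)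
    filter_upwards [eventually_gt_atTop 0] with n hn
    exact div_mul_cancel₀ _ (Nat.cast_ne_zero.2 hn.ne')
  have hharmonic := Real.tendsto_harmonic_sub_log
  have hinv := tendsto_inv_atTop_nhds_zero_nat (𝕜 := ℝ)
  have hlim := ((hharmonic.sub (hharmonic.comp ha_top)).add ((hinv.comp ha_top).sub hinv)).sub
    (hax.log hx.ne')
  rw [sub_self, sub_self, add_zero, zero_sub] at hlim
  refine hlim.congr' ?_
  filter_upwards [ha, ha_top.eventually_gt_atTop 0] with n han ha0
  have ha0' : (a n : ℝ) ≠ 0 := Nat.cast_ne_zero.2 ha0.ne'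
  have hn0 : (n : ℝ) ≠ 0 := Nat.cast_ne_zero.2 (ha0.trans_le han).ne'
  rw [sum_Ico_inv_eq_harmonic han, Real.log_div ha0' hn0]
  simp only [Function.comp_apply]
  ring

theorem tendsto_classicSuccess {a : ℕ → ℕ} {x : ℝ} (hx : 0 < x) (ha : ∀ᶠ n in atTop, a n ≤ n)
    (hax : Tendsto (fun n => (a n : ℝ) / n) atTop (𝓝 x)) :
    Tendsto (fun n => classicSuccess n (a n)) atTop (𝓝 (Real.negMulLog x)) := by
  simpa only [classicSuccess, Real.negMulLog, neg_mul, mul_neg] using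
    hax.mul (tendsto_sum_Ico_inv hx ha hax)

theorem tendsto_sampleSize_div :
    Tendsto (fun n => (sampleSize n : ℝ) / n) atTop (𝓝 (Real.exp 1)⁻¹) := by
  simpa only [sampleSize, div_eq_inv_mul, Function.comp_def] using
    (tendsto_nat_floor_mul_div_atTop (R := ℝ) (by positivity : 0 ≤ (Real.exp 1)⁻¹)).comp
      tendsto_natCast_atTop_atTop

theorem tendsto_classicSuccess_sampleSize :
    Tendsto (fun n => classicSuccess n (sampleSize n)) atTop (𝓝 (1 / Real.exp 1)) := by
  have hlim := tendsto_classicSuccess (a := sampleSize) (inv_pos.2 (Real.exp_pos 1)) ?_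
    tendsto_sampleSize_div
  · simpa [Real.negMulLog] using hlim
  · filter_upwards [eventually_gt_atTop 0] with n hn using (sampleSize_lt hn).le

/-- The distance to `1 / e` of the probability that the classic algorithm succeeds, plus the
probability `e / n` that the Simple Secretary mechanism does not use the sender values. -/
noncomputable def senderError (n : ℕ) : ℝ :=
  |classicSuccess n (sampleSize n) - 1 / Real.exp 1| + Real.exp 1 / n

theorem tendsto_senderError : Tendsto senderError atTop (𝓝 0) := by
  have hclassic := (tendsto_classicSuccess_sampleSize.sub_const (1 / Real.exp 1)).abs
  rw [sub_self, abs_zero] at hclassic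
  exact (add_zero (0 : ℝ)) ▸ hclassic.add (tendsto_const_div_atTop_nhds_zero_nat (Real.exp 1))

variable {n : ℕ}

theorem abs_senderSuccess_sub_le (hn : 3 ≤ n) (I : Instance n) :
    |(simpleSecretary n hn).senderSuccess I - 1 / Real.exp 1| ≤ senderError n := by
  have hn0 : 0 < n := Nat.zero_lt_of_lt hn
  have : Nonempty (Fin n) := ⟨⟨0, hn0⟩⟩
  obtain ⟨c, hc⟩ := Finite.exists_max I.ξ
  have hbest (i : Fin n) : I.IsSenderBest i ↔ i = c :=
    ⟨fun hi => I.ξ_injective ((hc i).antisymm (hi c)), fun hi => hi ▸ hc⟩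
  let a := uniformProb fun π : Equiv.Perm (Fin n) =>
    π (hireRound hn0 (sampleSize n) (I.ρ ∘ π)) = c
  let b := classicSuccess n (sampleSize n)
  have hb : uniformProb (fun π : Equiv.Perm (Fin n) =>
      π (hireRound hn0 (sampleSize n) (I.ξ ∘ π)) = c) = b :=
    uniformProb_hireRound_best I.ξ_injective hc hn0 (sampleSize_pos hn) (sampleSize_lt hn0)
  have hsuccess : (simpleSecretary n hn).senderSuccess I =
      Real.exp 1 / n * a + (1 - Real.exp 1 / n) * b := by
    simp only [Mechanism.senderSuccess, simpleSecretary_signals,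
      hiresAt_obedient_singleHire (Nat.zero_le _), exists_eq_left, hbest]
    rw [simpleSecretary_prob hn I fun π T => π T = c, mixProb, hb]
  have hab : |a - b| ≤ 1 := abs_sub_le_of_nonneg_of_le (uniformProb_nonneg _)
    (uniformProb_le_one _) (hb ▸ uniformProb_nonneg _) (hb ▸ uniformProb_le_one _)
  calc |(simpleSecretary n hn).senderSuccess I - 1 / Real.exp 1|
      = |(b - 1 / Real.exp 1) + Real.exp 1 / n * (a - b)| := by rw [hsuccess]; ring_nf
    _ ≤ |b - 1 / Real.exp 1| + Real.exp 1 / n * |a - b| := by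
        rw [← abs_of_nonneg (by positivity : 0 ≤ Real.exp 1 / n), ← abs_mul,
          abs_of_nonneg (by positivity : 0 ≤ Real.exp 1 / n)]
        exact abs_add_le _ _
    _ ≤ senderError n :=
        add_le_add_right (mul_le_of_le_one_right (by positivity) hab) _

theorem Mechanism.senderSuccess_mul_le_senderUtility (M : Mechanism n) (I : Instance n) :
    M.senderSuccess I * I.ξMax ≤ M.senderUtility I := by
  classical
  unfold senderSuccess prob senderUtility expect
  rw [Finset.sum_mul]
  refine Finset.sum_le_sum fun o _ => ?_
  beta_reduce
  rw [mul_assoc]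
  refine mul_le_mul_of_nonneg_left ?_ (M.weight_nonneg o)
  have hutility_nonneg (r : Fin n) :
      0 ≤ if HiresAt (obedient n) (M.signals I o) 0 r then I.ξ (o.1 r) else 0 :=
    ite_nonneg (I.ξ_nonneg _) le_rfl
  split_ifs with h
  · obtain ⟨r, hr, hbest⟩ := h
    have : Nonempty (Fin n) := ⟨r⟩
    calc 1 * I.ξMax ≤ I.ξ (o.1 r) := (one_mul I.ξMax).trans_le (ciSup_le hbest)
      _ = if HiresAt (obedient n) (M.signals I o) 0 r then I.ξ (o.1 r) else 0 := (if_pos hr).symm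
      _ ≤ _ := Finset.single_le_sum (fun r _ => hutility_nonneg r) (Finset.mem_univ r)
  · rw [zero_mul]
    exact Finset.sum_nonneg fun r _ => hutility_nonneg r

theorem Instance.ξMax_nonneg (I : Instance n) : 0 ≤ I.ξMax :=
  Real.iSup_nonneg I.ξ_nonneg

end Asymptotics

end OnlinePersuasion

theorem mainTheorem9 :
    (∀ (n : ℕ) (hn : 3 ≤ n), (OnlinePersuasion.simpleSecretary n hn).Persuasive) ∧
    ∃ ε : ℕ → ℝ, Tendsto ε atTop (𝓝 0) ∧
      ∀ (n : ℕ) (hn : 3 ≤ n) (I : OnlinePersuasion.Instance n),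
        |(OnlinePersuasion.simpleSecretary n hn).senderSuccess I - 1 / Real.exp 1| ≤ ε n ∧
        (1 / Real.exp 1 - ε n) * I.ξMax ≤
          (OnlinePersuasion.simpleSecretary n hn).senderUtility I := by
  refine ⟨fun n hn => OnlinePersuasion.simpleSecretary_persuasive hn,
    OnlinePersuasion.senderError, OnlinePersuasion.tendsto_senderError, fun n hn I => ?_⟩
  have hsuccess := OnlinePersuasion.abs_senderSuccess_sub_le hn I
  refine ⟨hsuccess, ?_⟩
  calc (1 / Real.exp 1 - OnlinePersuasion.senderError n) * I.ξMax
      ≤ (OnlinePersuasion.simpleSecretary n hn).senderSuccess I * I.ξMax :=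
        mul_le_mul_of_nonneg_right (by linarith [abs_le.1 hsuccess]) I.ξMax_nonneg
    _ ≤ (OnlinePersuasion.simpleSecretary n hn).senderUtility I :=
        (OnlinePersuasion.simpleSecretary n hn).senderSuccess_mul_le_senderUtility I
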